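/- All graphs are finite and simple. An orientation of a graph $G$ is a directed graph obtained by giving each edge of $G$ exactly one of its two directions. For an oriented graph $D$ with edge labels, the oriented vertex sum at a vertex $v$ is the sum of the labels of the edges oriented toward $v$ minus the sum of the labels of the edges oriented away from $v$. For an integer $k\ge 0$, $D$ is $k$-oriented-antimagic if there is an injective edge labeling $E(D)\to\{1,\dots,|E(D)|+k\}$ whose oriented vertex sums are pairwise distinct, and $k$-quasi-oriented-antimagic if there is an injective edge labeling $E(D)\to\{1,\dots,|E(D)|+k\}$ whose oriented vertex sums at non-isolated vertices are pairwise distinct. Theorem. Let $G$ be a graph on $n$ vertices. (1) $G$ admits an orientation that is $\lfloor 2n/3\rfloor$-quasi-oriented-antimagic. (2) If $G$ has no $K_1$ component (i.e. no isolated vertex), then $G$ admits an orientation that is $\lfloor 2n/3\rfloor$-oriented-antimagic. -/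

import Mathlib

namespace Digraph

variable {V : Type*}

/-- An oriented graph: between two vertices there is an arc in at most one direction
(in particular, there are no loops). -/
def IsOriented (D : Digraph V) : Prop :=
  ∀ u v, D.Adj u v → ¬ D.Adj v u

/-- `D` is an orientation of the simple graph `G`: an oriented graph with underlying graph `G`. -/
def IsOrientationOf (D : Digraph V) (G : SimpleGraph V) : Prop :=
  D.IsOriented ∧ D.toSimpleGraphInclusive = G

/-- The edge set of an oriented graph: the edges of its underlying simple graph. -/
def edgeSet (D : Digraph V) : Set (Sym2 V) :=
  D.toSimpleGraphInclusive.edgeSet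

open Classical in
/-- The oriented vertex sum at `v`: the sum of the labels of the edges oriented toward `v` minus
the sum of the labels of the edges oriented away from `v`. -/
noncomputable def orientedVertexSum [Fintype V] (D : Digraph V) (f : Sym2 V → ℕ) (v : V) : ℤ :=
  (∑ u with D.Adj u v, (f s(u, v) : ℤ)) - ∑ u with D.Adj v u, (f s(v, u) : ℤ)

/-- `f` restricts to an injective labeling of the edges of `D` with labels in
`{1, …, |E(D)| + k}`. The values of `f` off the edge set are irrelevant. -/
def IsInjectiveLabeling (D : Digraph V) (k : ℕ) (f : Sym2 V → ℕ) : Prop :=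
  Set.InjOn f D.edgeSet ∧ Set.MapsTo f D.edgeSet (Set.Icc 1 (D.edgeSet.ncard + k))

/-- `k`-oriented-antimagic: some injective edge labeling into `{1, …, |E| + k}` has pairwise
distinct oriented vertex sums. -/
def IsOrientedAntimagic [Fintype V] (D : Digraph V) (k : ℕ) : Prop :=
  ∃ f : Sym2 V → ℕ, D.IsInjectiveLabeling k f ∧
    ∀ u v, u ≠ v → D.orientedVertexSum f u ≠ D.orientedVertexSum f v

/-- `k`-quasi-oriented-antimagic: some injective edge labeling into `{1, …, |E| + k}` has pairwise
distinct oriented vertex sums at the non-isolated vertices. -/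
def IsQuasiOrientedAntimagic [Fintype V] (D : Digraph V) (k : ℕ) : Prop :=
  ∃ f : Sym2 V → ℕ, D.IsInjectiveLabeling k f ∧
    ∀ u v, ¬ D.toSimpleGraphInclusive.IsIsolated u → ¬ D.toSimpleGraphInclusive.IsIsolated v →
      u ≠ v → D.orientedVertexSum f u ≠ D.orientedVertexSum f v

end Digraph

/-!
The vertices of positive degree are covered by disjoint stars: a set `N` of leaves, a set `C` of
centers, and a map `π` from `N` onto `C` sending each leaf to an adjacent center
(`SimpleGraph.exists_star_cover`). Since `π` is onto, there are at most `n / 2` centers.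

The star edges receive the largest labels, and all edges between `N` and the rest are oriented
towards `N`. The edges inside `N` or inside `C` could disturb the sums, so they are oriented and
labeled in such a way that no vertex loses more than the largest label used on them
(`SimpleGraph.exists_signedLabeling`: run through a trail backwards, with increasing labels, and
start a new trail only when the current one cannot be extended); inside `C` this orientation is
reversed. Hence every leaf has a positive sum and every center a negative one, whatever the labels
of the star edges are.

Let `x v` be the label of the star edge at the leaf `v`. It remains to choose distinct values `x v`
in an interval so that the sums `x v + w v` of the leaves are distinct, and so that the sums
`w c - ∑_{π v = c} x v` of the centers are distinct. By the combinatorial Nullstellensatz, this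
is possible with `|N| + |C| - 1` available labels if the polynomial `W * W * f` has a suitable
nonzero coefficient, where `W` is the Vandermonde polynomial in the `x v`, and `f` is the
Vandermonde polynomial in the star sums `∑_{π v = c} x v`. The exponents in `f` are at most
`|C| - 1`, so it suffices to find a monomial `μ` of `f` such that `μ * ∏ (x v) ^ (|N| - 1)` has a
nonzero coefficient. As `W` is, up to sign and a monomial, invariant under inverting all variables,
the sum of these coefficients, weighted by the coefficients of `f`, is up to sign the sum of the
squares of the coefficients of `W * f`, which is positive
(`exists_coeff_vandermonde_sq_mul_ne_zero`).

The number of available labels is `|N| + k`, so every `k ≥ n / 2 - 1` is admissible; in particular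
`k = ⌊2n/3⌋` is.
-/

/-! ### A nonvanishing coefficient -/

open MvPolynomial in
/-- With `W` the Vandermonde polynomial, `W * (W * f)` has a nonzero coefficient at some monomial of
`f` shifted by `∏ X i ^ (n - 1)`. On the unit torus, `W * W` is `∏ X i ^ (n - 1)` times `± |W| ^ 2`,
so these coefficients are the pairings of `f` with its own monomials under a positive definite
form, and they cannot all vanish. -/
theorem exists_coeff_vandermonde_sq_mul_ne_zero {n : ℕ} {f : MvPolynomial (Fin n) ℤ}
    (hf : f ≠ 0) :
    ∃ μ ∈ f.support, coeff (μ + Finsupp.equivFunOnFinite.symm (fun _ => n - 1))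
      ((Matrix.vandermonde (X : Fin n → MvPolynomial (Fin n) ℤ)).det *
        ((Matrix.vandermonde (X : Fin n → MvPolynomial (Fin n) ℤ)).det * f)) ≠ 0 := by
  set W : MvPolynomial (Fin n) ℤ :=
    (Matrix.vandermonde (X : Fin n → MvPolynomial (Fin n) ℤ)).det with hW
  set δ : Fin n →₀ ℕ := Finsupp.equivFunOnFinite.symm (fun _ => n - 1) with hδ
  let e : Equiv.Perm (Fin n) → (Fin n →₀ ℕ) := fun σ =>
    Finsupp.equivFunOnFinite.symm (fun i => (σ i : ℕ))
  have hdet : W = ∑ σ : Equiv.Perm (Fin n), monomial (e σ) ((Equiv.Perm.sign σ : ℤ)) := by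
    rw [hW, ← Matrix.det_transpose, Matrix.det_apply']
    refine Finset.sum_congr rfl fun σ _ => ?_
    rw [monomial_eq, Finsupp.prod_fintype _ _ (by simp)]
    simp [e, Matrix.vandermonde_apply]
  -- Reversing the order of the exponents `0, …, n - 1` changes `W` by a sign only.
  have hrev : W = ∑ σ : Equiv.Perm (Fin n), monomial (e (Fin.revPerm * σ))
      ((Equiv.Perm.sign (Fin.revPerm : Equiv.Perm (Fin n)) : ℤ) * (Equiv.Perm.sign σ : ℤ)) := by
    rw [hdet, ← Equiv.sum_comp (Equiv.mulLeft Fin.revPerm)]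
    simp
  have hadd : ∀ σ, e (Fin.revPerm * σ) + e σ = δ := by
    intro σ
    ext i
    have := (σ i).isLt
    simp [e, hδ, Fin.val_rev]
    omega
  have hWne : W ≠ 0 :=
    Matrix.det_vandermonde_ne_zero_iff.mpr (X_injective)
  have hg : W * f ≠ 0 := mul_ne_zero hWne hf
  by_contra! hcon
  set g := W * f with hgdef
  have hzero : ∀ μ ∈ f.support,
      ∑ σ : Equiv.Perm (Fin n), (Equiv.Perm.sign σ : ℤ) * coeff (e σ + μ) g = 0 := by
    intro μ hμ
    have h := hcon μ hμ
    rw [hrev, Finset.sum_mul, coeff_sum] at h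
    have h2 : ∀ σ : Equiv.Perm (Fin n), coeff (μ + δ) (monomial (e (Fin.revPerm * σ))
        ((Equiv.Perm.sign (Fin.revPerm : Equiv.Perm (Fin n)) : ℤ) * (Equiv.Perm.sign σ : ℤ)) * g)
        = (Equiv.Perm.sign (Fin.revPerm : Equiv.Perm (Fin n)) : ℤ) *
          ((Equiv.Perm.sign σ : ℤ) * coeff (e σ + μ) g) := by
      intro σ
      rw [show μ + δ = e (Fin.revPerm * σ) + (e σ + μ) by rw [← hadd σ]; abel,
        coeff_monomial_mul, mul_assoc]
    rw [Finset.sum_congr rfl fun σ _ => h2 σ, ← Finset.mul_sum] at h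
    exact (mul_eq_zero.mp h).resolve_left (by simp)
  -- For the pairing `φ p = ∑ α, p_α g_α` with `g`, the value `φ g` is a sum of squares.
  let φ : MvPolynomial (Fin n) ℤ →ₗ[ℤ] ℤ :=
    (basisMonomials (Fin n) ℤ).constr ℤ (fun α => coeff α g)
  have hφ : ∀ α a, φ (monomial α a) = a * coeff α g := by
    intro α a
    have : monomial α a = a • (basisMonomials (Fin n) ℤ) α := by
      simp [coe_basisMonomials, smul_monomial]
    rw [this, map_smul, Module.Basis.constr_basis, smul_eq_mul]
  have h1 : φ g = ∑ α ∈ g.support, coeff α g * coeff α g := by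
    have h := congrArg φ g.as_sum
    rwa [map_sum, Finset.sum_congr rfl fun α _ => hφ α _] at h
  have h2 : φ g = 0 := by
    rw [hgdef, hdet, Finset.sum_mul]
    conv_lhs => rw [f.as_sum]
    simp only [Finset.mul_sum, monomial_mul, map_sum, hφ]
    rw [Finset.sum_comm]
    refine Finset.sum_eq_zero fun μ hμ => ?_
    have := congrArg (coeff μ f * ·) (hzero μ hμ)
    simp only [Finset.mul_sum, mul_zero] at this
    rw [← this]
    exact Finset.sum_congr rfl fun σ _ => by ring
  obtain ⟨α, hα⟩ := support_nonempty.mpr hg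
  have h3 : 0 < ∑ α ∈ g.support, coeff α g * coeff α g :=
    Finset.sum_pos (fun α hα => mul_self_pos.mpr (mem_support_iff.mp hα)) ⟨α, hα⟩
  omega

/-! ### Top homogeneous parts -/

/-- `p` has degree at most `d`, and `h` is its homogeneous part of degree `d` (possibly zero). The
bound on the degree is encoded by comparing all coefficients in degrees at least `d`. -/
def HasTopPart {σ : Type*} (d : ℕ) (p h : MvPolynomial σ ℤ) : Prop :=
  h.IsHomogeneous d ∧ ∀ α : σ →₀ ℕ, d ≤ α.degree → p.coeff α = h.coeff α

namespace HasTopPart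
open MvPolynomial
variable {σ : Type*} {d d' : ℕ} {p p' h h' : MvPolynomial σ ℤ}

theorem coeff_eq_zero (H : HasTopPart d p h) {α : σ →₀ ℕ} (hα : d < α.degree) :
    p.coeff α = 0 ∧ h.coeff α = 0 := by
  have : h.coeff α = 0 := H.1.coeff_eq_zero hα.ne'
  exact ⟨(H.2 α hα.le).trans this, this⟩

theorem mul (H : HasTopPart d p h) (H' : HasTopPart d' p' h') :
    HasTopPart (d + d') (p * p') (h * h') := by
  classical
  refine ⟨H.1.mul H'.1, fun α hα => ?_⟩
  rw [coeff_mul, coeff_mul]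
  refine Finset.sum_congr rfl fun x hx => ?_
  rw [← Finset.HasAntidiagonal.mem_antidiagonal.mp hx, map_add] at hα
  rcases lt_trichotomy x.1.degree d with h1 | h1 | h1
  · have := H'.coeff_eq_zero (α := x.2) (by omega)
    simp [this.1, this.2]
  · rw [H.2 _ h1.ge, H'.2 _ (by omega)]
  · have := H.coeff_eq_zero h1
    simp [this.1, this.2]

theorem prod {κ : Type*} (s : Finset κ) {d : κ → ℕ} {p h : κ → MvPolynomial σ ℤ}
    (H : ∀ a ∈ s, HasTopPart (d a) (p a) (h a)) :
    HasTopPart (∑ a ∈ s, d a) (∏ a ∈ s, p a) (∏ a ∈ s, h a) := by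
  classical
  induction s using Finset.induction_on with
  | empty => exact ⟨by simpa using isHomogeneous_one σ ℤ, by simp⟩
  | insert a s ha ih =>
    rw [Finset.sum_insert ha, Finset.prod_insert ha, Finset.prod_insert ha]
    exact (H a (Finset.mem_insert_self a s)).mul
      (ih fun b hb => H b (Finset.mem_insert_of_mem hb))

theorem add_C {L : MvPolynomial σ ℤ} (hL : L.IsHomogeneous 1) (c : ℤ) :
    HasTopPart 1 (L + C c) L := by
  classical
  refine ⟨hL, fun α hα => ?_⟩
  have : (0 : σ →₀ ℕ) ≠ α := by rintro rfl; simp at hα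
  rw [coeff_add, coeff_C, if_neg this, add_zero]

theorem det_vandermonde {m : ℕ} {L : Fin m → MvPolynomial σ ℤ}
    (hL : ∀ j, (L j).IsHomogeneous 1) (c : Fin m → ℤ) :
    ∃ d, HasTopPart d (Matrix.vandermonde fun j => L j + C (c j)).det
      (Matrix.vandermonde L).det := by
  refine ⟨∑ i : Fin m, ∑ _j ∈ Finset.Ioi i, 1, ?_⟩
  rw [Matrix.det_vandermonde, Matrix.det_vandermonde]
  refine prod _ fun i _ => prod _ fun j _ => ?_
  have : L j + C (c j) - (L i + C (c i)) = (L j - L i) + C (c j - c i) := by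
    rw [C_sub]; ring
  rw [this]
  exact add_C ((hL j).sub (hL i)) _

/-- The combinatorial Nullstellensatz, with the coefficient taken from the top part. -/
theorem exists_eval_ne_zero [Finite σ] (H : HasTopPart d p h) {t : σ →₀ ℕ} (ht : h.coeff t ≠ 0)
    (S : Finset ℤ) (hS : ∀ i, t i < S.card) :
    ∃ x : σ → ℤ, (∀ i, x i ∈ S) ∧ eval x p ≠ 0 := by
  have htd : t.degree = d := by
    by_contra hne
    exact ht (H.1.coeff_eq_zero hne)
  have hpt : p.coeff t ≠ 0 := by rwa [H.2 t htd.ge]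
  refine combinatorial_nullstellensatz_exists_eval_nonzero p t hpt (le_antisymm ?_ ?_)
    (fun _ => S) hS
  · refine Finset.sup_le fun α hα => ?_
    rw [htd]
    by_contra! hlt
    exact mem_support_iff.mp hα (H.coeff_eq_zero hlt).1
  · exact le_totalDegree (mem_support_iff.mpr hpt)

end HasTopPart

/-! ### Labels for the stars -/

open MvPolynomial in
theorem degreeOf_det_vandermonde_le {σ : Type*} {m : ℕ} (L : Fin m → MvPolynomial σ ℤ) (i : σ)
    (j₀ : Fin m) (h1 : degreeOf i (L j₀) ≤ 1) (h0 : ∀ j, j ≠ j₀ → degreeOf i (L j) = 0) :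
    degreeOf i (Matrix.vandermonde L).det ≤ m - 1 := by
  rw [← Matrix.det_transpose, Matrix.det_apply]
  refine (degreeOf_sum_le _ _ _).trans (Finset.sup_le fun τ _ => ?_)
  have : degreeOf i (∏ j, (Matrix.vandermonde L).transpose (τ j) j) ≤ m - 1 := by
    refine (degreeOf_prod_le _ _ _).trans ?_
    rw [Finset.sum_eq_single j₀]
    · rw [Matrix.transpose_apply, Matrix.vandermonde_apply]
      refine (degreeOf_pow_le _ _ _).trans ?_
      have := (τ j₀).isLt
      nlinarith [Nat.mul_le_mul_left (τ j₀ : ℕ) h1, Nat.le_sub_one_of_lt this]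
    · intro j _ hj
      rw [Matrix.transpose_apply, Matrix.vandermonde_apply]
      have := degreeOf_pow_le i (L j) (τ j)
      rw [h0 j hj, mul_zero] at this
      omega
    · simp
  rcases Int.units_eq_one_or (Equiv.Perm.sign τ) with h | h <;> rw [h]
  · simpa using this
  · simpa [degreeOf_neg] using this

open MvPolynomial in
/-- Any `n + m - 1` integers suffice to label `n` points such that the labels, the labels shifted by
prescribed amounts, and the shifted sums over the `m` fibers of `π` are each pairwise distinct. -/
theorem exists_labels_fin {n m : ℕ} (π : Fin n → Fin m) (hπ : Function.Surjective π)
    (w : Fin n → ℤ) (q : Fin m → ℤ) (S : Finset ℤ) (hS : n + m ≤ S.card + 1) :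
    ∃ x : Fin n → ℤ, (∀ i, x i ∈ S) ∧ Function.Injective x ∧
      Function.Injective (fun i => x i + w i) ∧
      Function.Injective (fun j => (∑ i with π i = j, x i) + q j) := by
  let L : Fin m → MvPolynomial (Fin n) ℤ := fun j => ∑ i with π i = j, X i
  have hL : ∀ j, (L j).IsHomogeneous 1 := fun j =>
    IsHomogeneous.sum _ _ _ fun i _ => isHomogeneous_X ℤ i
  have hLc : ∀ i j, coeff (Finsupp.single i 1) (L j) = if π i = j then 1 else 0 := by
    intro i j
    simp only [L, coeff_sum, coeff_X, Finsupp.single_left_inj one_ne_zero]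
    simp [Finset.sum_ite_eq']
  have hLinj : Function.Injective L := by
    intro j j' h
    obtain ⟨i, rfl⟩ := hπ j
    by_contra hne
    have := congrArg (coeff (Finsupp.single i 1)) h
    simp [hLc, hne] at this
  have hf : (Matrix.vandermonde L).det ≠ 0 := Matrix.det_vandermonde_ne_zero_iff.mpr hLinj
  obtain ⟨μ, hμ, hne⟩ := exists_coeff_vandermonde_sq_mul_ne_zero hf
  obtain ⟨d₁, H₁⟩ := HasTopPart.det_vandermonde (L := (X : Fin n → MvPolynomial (Fin n) ℤ))
    (fun i => isHomogeneous_X ℤ i) 0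
  obtain ⟨d₂, H₂⟩ := HasTopPart.det_vandermonde (L := (X : Fin n → MvPolynomial (Fin n) ℤ))
    (fun i => isHomogeneous_X ℤ i) w
  obtain ⟨d₃, H₃⟩ := HasTopPart.det_vandermonde hL q
  have hdeg : ∀ i, μ i ≤ m - 1 := fun i =>
    (monomial_le_degreeOf i hμ).trans <| degreeOf_det_vandermonde_le L i (π i)
      ((degreeOf_sum_le _ _ _).trans (Finset.sup_le fun k _ => by
        rw [degreeOf_X]; split_ifs <;> simp))
      (fun j hj => Nat.le_zero.mp <|
        (degreeOf_sum_le _ _ _).trans (Finset.sup_le fun k hk => by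
          rw [degreeOf_X, if_neg]
          rintro rfl
          exact hj (Finset.mem_filter.mp hk).2.symm))
  obtain ⟨x, hxS, hx⟩ := (H₁.mul (H₂.mul H₃)).exists_eval_ne_zero hne S (fun i => by
    have := hdeg i
    have h1 := (π i).isLt
    have h2 := i.isLt
    simp
    omega)
  -- A nonzero value of a Vandermonde determinant means that its nodes take distinct values.
  have key : ∀ {r : ℕ} (v : Fin r → MvPolynomial (Fin n) ℤ),
      eval x (Matrix.vandermonde v).det ≠ 0 → Function.Injective (fun j => eval x (v j)) := by
    intro r v hv
    rw [Matrix.det_vandermonde, map_prod] at hv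
    rw [← Matrix.det_vandermonde_ne_zero_iff, Matrix.det_vandermonde]
    simpa [map_prod] using hv
  rw [map_mul, map_mul] at hx
  have k₁ := key _ (left_ne_zero_of_mul hx)
  have k₂ := key _ (left_ne_zero_of_mul (right_ne_zero_of_mul hx))
  have k₃ := key _ (right_ne_zero_of_mul (right_ne_zero_of_mul hx))
  refine ⟨x, hxS, by simpa using k₁, by simpa using k₂, by simpa [L] using k₃⟩

/-- The form of `exists_labels_fin` for a map between finsets, with the fiber sums negated. -/
theorem exists_labels {V : Type*} [DecidableEq V] (N C : Finset V) (π : V → V)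
    (hπ : ∀ v ∈ N, π v ∈ C) (hsurj : ∀ c ∈ C, ∃ v ∈ N, π v = c) (w : V → ℤ)
    (S : Finset ℤ) (hS : N.card + C.card ≤ S.card + 1) :
    ∃ x : V → ℤ, (∀ v ∈ N, x v ∈ S) ∧ Set.InjOn x N ∧ Set.InjOn (fun v => x v + w v) N ∧
      Set.InjOn (fun c => w c - ∑ v ∈ N with π v = c, x v) C := by
  let a := N.equivFin
  let b := C.equivFin
  obtain ⟨x, hxS, h₁, h₂, h₃⟩ := exists_labels_fin
    (fun i => b ⟨π (a.symm i), hπ _ (a.symm i).2⟩)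
    (fun j => by
      obtain ⟨v, hv, hvc⟩ := hsurj _ (b.symm j).2
      exact ⟨a ⟨v, hv⟩, by simp [hvc]⟩)
    (fun i => w (a.symm i)) (fun j => - w (b.symm j)) S hS
  let y : V → ℤ := fun v => if h : v ∈ N then x (a ⟨v, h⟩) else 0
  have hy : ∀ v (h : v ∈ N), y v = x (a ⟨v, h⟩) := fun v h => dif_pos h
  have hsum : ∀ c (hc : c ∈ C), ∑ v ∈ N with π v = c, y v =
      ∑ i with b ⟨π (a.symm i), hπ _ (a.symm i).2⟩ = b ⟨c, hc⟩, x i := by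
    intro c hc
    rw [Finset.sum_filter, Finset.sum_filter, ← Finset.sum_coe_sort N, ← a.sum_comp]
    refine Finset.sum_congr rfl fun v _ => ?_
    simp [hy]
  refine ⟨y, fun v hv => by rw [hy v hv]; exact hxS _, ?_, ?_, ?_⟩
  · intro u hu v hv huv
    rw [hy u hu, hy v hv] at huv
    simpa using h₁ huv
  · intro u hu v hv huv
    simp only [hy u hu, hy v hv] at huv
    have := @h₂ (a ⟨u, hu⟩) (a ⟨v, hv⟩) (by simpa using huv)
    simpa using this
  · intro c hc d hd hcd
    simp only [hsum c hc, hsum d hd] at hcd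
    have := @h₃ (b ⟨c, hc⟩) (b ⟨d, hd⟩) (by simp only [Equiv.symm_apply_apply]; linarith)
    simpa using this

namespace SimpleGraph

/-! ### Covering by stars -/

/-- Any set of non-isolated vertices can be covered by disjoint stars, with leaves `N`, centers `C`,
and `π` sending each leaf to its center. -/
theorem exists_star_cover {V : Type*} [DecidableEq V] (G : SimpleGraph V) (S : Finset V)
    (hS : ∀ v ∈ S, ¬ G.IsIsolated v) :
    ∃ (N C : Finset V) (π : V → V), Disjoint N C ∧ S ⊆ N ∪ C ∧
      (∀ v ∈ N, π v ∈ C ∧ G.Adj v (π v)) ∧ ∀ c ∈ C, ∃ v ∈ N, π v = c := by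
  induction S using Finset.induction_on with
  | empty => exact ⟨∅, ∅, id, by simp, by simp, by simp, by simp⟩
  | insert v S _ ih =>
    obtain ⟨N, C, π, hd, hc, hN, hC⟩ := ih fun u hu => hS u (Finset.mem_insert_of_mem hu)
    by_cases hv : v ∈ N ∪ C
    · exact ⟨N, C, π, hd, Finset.insert_subset hv hc, hN, hC⟩
    rw [Finset.mem_union, not_or] at hv
    obtain ⟨hvN, hvC⟩ := hv
    have hv := hS v (Finset.mem_insert_self v S)
    simp only [IsIsolated, not_forall, not_not] at hv
    obtain ⟨u, hvu⟩ := hv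
    have hne := hvu.ne
    rw [Finset.disjoint_left] at hd
    by_cases huN : u ∈ N
    · have huC := hd huN
      obtain ⟨hπC, hadj⟩ := hN u huN
      have hπN : π u ∉ N := fun h => hd h hπC
      by_cases hex : ∃ u' ∈ N, u' ≠ u ∧ π u' = π u
      · -- Detach the leaf `u` from its star and let it be the center of a new star.
        refine ⟨insert v (N.erase u), insert u C, Function.update π v u, ?_, ?_, ?_, ?_⟩
        · rw [Finset.disjoint_left]; grind
        · grind
        · grind
        · intro c hc'
          rcases Finset.mem_insert.mp hc' with rfl | hc'
          · exact ⟨v, by simp⟩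
          · obtain ⟨z, hz, hzc⟩ := hC c hc'
            obtain ⟨u', hu', h1, h2⟩ := hex
            by_cases hzu : z = u
            · exact ⟨u', by grind⟩
            · exact ⟨z, by grind⟩
      · -- The star of `u` is a single edge: interchange its center and its leaf.
        push Not at hex
        refine ⟨insert v (insert (π u) (N.erase u)), insert u (C.erase (π u)),
          Function.update (Function.update π (π u) u) v u, ?_, ?_, ?_, ?_⟩
        · rw [Finset.disjoint_left]; grind
        · grind
        · have := hadj.symm
          grind
        · intro c hc'
          rcases Finset.mem_insert.mp hc' with rfl | hc'
          · exact ⟨v, by simp⟩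
          · obtain ⟨z, hz, hzc⟩ := hC c (Finset.mem_of_mem_erase hc')
            exact ⟨z, by grind⟩
    · -- The star of `u` is extended, or created, by the leaf `v`.
      refine ⟨insert v N, insert u C, Function.update π v u, ?_, ?_, ?_, ?_⟩
      · rw [Finset.disjoint_left]; grind
      · grind
      · grind
      · intro c hc'
        rcases Finset.mem_insert.mp hc' with rfl | hc'
        · exact ⟨v, by simp⟩
        · obtain ⟨z, hz, hzc⟩ := hC c hc'
          exact ⟨z, by grind⟩

/-! ### Signed labelings -/

variable {V : Type*}

/-- An orientation of `H` together with an injective edge labeling by elements of `A`, encoded as an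
antisymmetric function: `g v u = a > 0` means that the edge `uv` is oriented from `u` to `v` and has
label `a`. The oriented vertex sum at `v` is thus `∑ u, g v u`. -/
structure IsSignedLabeling (g : V → V → ℤ) (H : SimpleGraph V) (A : Set ℕ) : Prop where
  antisymm : ∀ u v, g v u = - g u v
  ne_zero_iff : ∀ u v, g u v ≠ 0 ↔ H.Adj u v
  inj : ∀ u v x y, H.Adj u v → H.Adj x y → (g u v).natAbs = (g x y).natAbs → s(u, v) = s(x, y)
  mem : ∀ u v, H.Adj u v → (g u v).natAbs ∈ A

namespace IsSignedLabeling
variable {g g' : V → V → ℤ} {H H' : SimpleGraph V} {A A' : Set ℕ}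

theorem eq_zero (h : IsSignedLabeling g H A) {u v : V} (huv : ¬ H.Adj u v) : g u v = 0 :=
  not_ne_iff.mp fun h0 => huv ((h.ne_zero_iff u v).mp h0)

theorem zero (A : Set ℕ) : IsSignedLabeling (0 : V → V → ℤ) ⊥ A :=
  ⟨by simp, by simp, by simp, by simp⟩

theorem mono (h : IsSignedLabeling g H A) (hA : A ⊆ A') : IsSignedLabeling g H A' :=
  ⟨h.antisymm, h.ne_zero_iff, h.inj, fun u v huv => hA (h.mem u v huv)⟩

theorem reorient (h : IsSignedLabeling g H A) (hanti : ∀ u v, g' v u = - g' u v)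
    (habs : ∀ u v, (g' u v).natAbs = (g u v).natAbs) : IsSignedLabeling g' H A :=
  ⟨hanti, fun u v => by rw [← h.ne_zero_iff, ← Int.natAbs_ne_zero, habs, Int.natAbs_ne_zero],
    fun u v x y => by rw [habs, habs]; exact h.inj u v x y,
    fun u v => by rw [habs]; exact h.mem u v⟩

theorem add (h : IsSignedLabeling g H A) (h' : IsSignedLabeling g' H' A')
    (hH : ∀ u v, H.Adj u v → ¬ H'.Adj u v) (hA : Disjoint A A') :
    IsSignedLabeling (g + g') (H ⊔ H') (A ∪ A') := by
  have key : ∀ u v, (H.Adj u v ∧ ¬ H'.Adj u v ∧ (g + g') u v = g u v) ∨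
      (¬ H.Adj u v ∧ H'.Adj u v ∧ (g + g') u v = g' u v) ∨
      (¬ H.Adj u v ∧ ¬ H'.Adj u v ∧ (g + g') u v = 0) := by
    intro u v
    by_cases h1 : H.Adj u v
    · have := hH u v h1
      simp [h1, this, h'.eq_zero this]
    · by_cases h2 : H'.Adj u v
      · simp [h1, h2, h.eq_zero h1]
      · simp [h1, h2, h.eq_zero h1, h'.eq_zero h2]
  refine ⟨fun u v => ?_, fun u v => ?_, fun u v x y huv hxy heq => ?_, fun u v huv => ?_⟩
  · simp only [Pi.add_apply, h.antisymm u v, h'.antisymm u v]; ring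
  · have := h.ne_zero_iff u v
    have := h'.ne_zero_iff u v
    rw [sup_adj]
    rcases key u v with ⟨h1, h2, h3⟩ | ⟨h1, h2, h3⟩ | ⟨h1, h2, h3⟩ <;> rw [h3] <;> tauto
  · rw [sup_adj] at huv hxy
    rw [Set.disjoint_left] at hA
    rcases key u v with ⟨h1, h2, h3⟩ | ⟨h1, h2, h3⟩ | ⟨h1, h2, h3⟩ <;>
      rcases key x y with ⟨k1, k2, k3⟩ | ⟨k1, k2, k3⟩ | ⟨k1, k2, k3⟩ <;>
      rw [h3, k3] at heq
    · exact h.inj u v x y h1 k1 heq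
    · exact absurd (h'.mem x y k2) (hA (heq ▸ h.mem u v h1))
    · tauto
    · exact absurd (h'.mem u v h2) (hA (heq ▸ h.mem x y k1))
    · exact h'.inj u v x y h2 k2 heq
    · tauto
    · tauto
    · tauto
    · tauto
  · rw [sup_adj] at huv
    rcases key u v with ⟨h1, h2, h3⟩ | ⟨h1, h2, h3⟩ | ⟨h1, h2, h3⟩ <;> rw [h3]
    · exact Or.inl (h.mem u v h1)
    · exact Or.inr (h'.mem u v h2)
    · tauto

open Classical in
/-- A single edge, oriented from `u` to `v`, with label `a`. -/
theorem single {u v : V} (huv : u ≠ v) {a : ℕ} (ha : a ≠ 0) :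
    IsSignedLabeling (fun x y => (if x = v ∧ y = u then (a : ℤ) else 0) -
      (if x = u ∧ y = v then (a : ℤ) else 0)) (edge u v) {a} := by
  refine ⟨fun x y => ?_, fun x y => ?_, fun x y z t h1 h2 _ => ?_, fun x y h1 => ?_⟩
  · grind
  · rw [edge_adj]; grind
  · rw [edge_adj] at h1 h2
    rw [Sym2.eq_iff]; grind
  · rw [edge_adj] at h1
    simp only [Set.mem_singleton_iff]
    rcases h1.1 with ⟨rfl, rfl⟩ | ⟨rfl, rfl⟩
    · simp [huv]
    · simp [huv, huv.symm]

end IsSignedLabeling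

/-! ### Labelings with bounded losses -/

/-- The inductive form of `exists_signedLabeling`. Here `s` holds the sums after the labels up to
`b` have been used, `H` consists of the edges not yet labeled, and `u` is the present first vertex
of the trail being extended backwards: the only vertex with edges left whose sum may be negative. -/
theorem exists_signedLabeling_aux [Fintype V] (r : ℕ) :
    ∀ (H : SimpleGraph V) (b : ℕ) (s : V → ℤ) (u : V), H.edgeSet.ncard = r →
      (∀ v, -(b : ℤ) ≤ s v) → (∀ v, v ≠ u → ¬ H.IsIsolated v → 0 ≤ s v) →
      ∃ g, IsSignedLabeling g H (Set.Ioc b (b + r)) ∧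
        ∀ v, -((b + r : ℕ) : ℤ) ≤ s v + ∑ y, g v y := by
  classical
  induction r with
  | zero =>
    intro H b s u hr hs _
    have : H = ⊥ := by
      rw [← edgeSet_eq_empty]
      exact (Set.ncard_eq_zero (Set.toFinite _)).mp hr
    subst this
    exact ⟨0, .zero _, by simpa using hs⟩
  | succ r ih =>
    intro H b s u hr hs hs0
    -- The next edge goes from `u'` to `t`. It extends the trail at `u` if `u` has an edge left.
    obtain ⟨u', t, hadj, hut⟩ : ∃ u' t, H.Adj u' t ∧ (¬ H.IsIsolated u → t = u) := by
      by_cases hu : H.IsIsolated u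
      · have : H ≠ ⊥ := by
          rintro rfl
          simp at hr
        obtain ⟨x, y, hxy⟩ := ne_bot_iff_exists_adj.mp this
        exact ⟨x, y, hxy, fun h => absurd hu h⟩
      · have hu' := hu
        simp only [IsIsolated, not_forall, not_not] at hu'
        obtain ⟨x, hx⟩ := hu'
        exact ⟨x, u, hx.symm, fun _ => rfl⟩
    have hne := hadj.ne
    have hu'iso : ¬ H.IsIsolated u' := fun h => h t hadj
    have hu'u : u' ≠ u := by
      rintro rfl
      exact hne (hut hu'iso).symm
    have hcard : (H \ edge u' t).edgeSet.ncard = r := by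
      rw [edgeSet_sdiff, edgeSet_edge_of_ne hne,
        Set.ncard_sdiff_singleton_of_mem (show s(u', t) ∈ H.edgeSet from hadj), hr]
      simp
    have hsub : ∀ v, ¬ (H \ edge u' t).IsIsolated v → ¬ H.IsIsolated v := by
      intro v hv h
      exact hv fun w hw => h w hw.1
    obtain ⟨g, hg, hsum⟩ := ih (H \ edge u' t) (b + 1)
      (fun z => s z + ((if z = t then ((b + 1 : ℕ) : ℤ) else 0) -
        (if z = u' then ((b + 1 : ℕ) : ℤ) else 0))) u' hcard
      (fun z => by
        have h1 := hs z
        have h2 := hs0 u' hu'u hu'iso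
        grind)
      (fun z hz hziso => by
        have h1 := hs z
        have h2 := hs0 z
        have h3 := hsub z hziso
        by_cases hzt : z = t
        · simp only [hzt, if_true, if_neg (hzt ▸ hz)]
          rw [hzt] at h1
          push_cast
          linarith
        · have hzu : z ≠ u := by
            rintro rfl
            exact hzt (hut h3).symm
          simpa [hz, hzt] using h2 hzu h3)
    have h := (IsSignedLabeling.single hne (Nat.succ_ne_zero b)).add hg
      (fun x y h h' => h'.2 h) (by
        rw [Set.disjoint_singleton_left]; simp)
    rw [sup_sdiff_cancel_right (by
      rw [edge_le_iff]; exact Or.inr hadj)] at h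
    refine ⟨_, h.mono ?_, fun v => ?_⟩
    · rintro a (rfl | ha)
      · simp
      · simp only [Set.mem_Ioc] at ha ⊢; omega
    · have := hsum v
      simp only [Pi.add_apply, Finset.sum_add_distrib, Finset.sum_sub_distrib]
      have e1 : ∀ p q : V, ∑ y, (if v = p ∧ y = q then ((b.succ : ℕ) : ℤ) else 0) =
          if v = p then ((b + 1 : ℕ) : ℤ) else 0 := by
        intro p q
        by_cases h : v = p <;> simp [h]
      rw [e1, e1]
      push_cast at this ⊢
      linarith

/-- Every graph has an orientation and an injective labeling by the integers in
`(b, b + |E(H)|]` whose vertex sums are bounded below by minus the largest label. -/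
theorem exists_signedLabeling [Fintype V] (H : SimpleGraph V) (b : ℕ) :
    ∃ g, IsSignedLabeling g H (Set.Ioc b (b + H.edgeSet.ncard)) ∧
      ∀ v, -((b + H.edgeSet.ncard : ℕ) : ℤ) ≤ ∑ y, g v y := by
  cases isEmpty_or_nonempty V with
  | inl h => exact ⟨0, ⟨by simp, fun u => (IsEmpty.false u).elim, fun u => (IsEmpty.false u).elim,
      fun u => (IsEmpty.false u).elim⟩, fun u => (IsEmpty.false u).elim⟩
  | inr h =>
    obtain ⟨g, hg, hs⟩ := exists_signedLabeling_aux _ H b 0 (Classical.arbitrary V) rfl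
      (by simp) (by simp)
    exact ⟨g, hg, by simpa using hs⟩

/-! ### Assembling the labeling -/

theorem IsSignedLabeling.exists_digraph [Fintype V] {g : V → V → ℤ} {G : SimpleGraph V} {k : ℕ}
    (h : IsSignedLabeling g G (Set.Icc 1 (G.edgeSet.ncard + k)))
    (hg : ∀ u v, ¬ G.IsIsolated u → ¬ G.IsIsolated v → u ≠ v → ∑ y, g u y ≠ ∑ y, g v y) :
    ∃ D : Digraph V, D.IsOrientationOf G ∧ D.IsQuasiOrientedAntimagic k := by
  classical
  let D : Digraph V := ⟨fun u v => 0 < g v u⟩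
  have hD : ∀ u v, D.Adj u v ↔ 0 < g v u := fun _ _ => Iff.rfl
  have hDG : D.toSimpleGraphInclusive = G := by
    ext u v
    simp only [Digraph.toSimpleGraphInclusive, fromRel_adj, hD]
    have h1 := h.antisymm u v
    have h2 := h.ne_zero_iff u v
    have h3 : G.Adj u v → u ≠ v := Adj.ne
    constructor
    · rintro ⟨_, h | h⟩ <;> exact h2.mp (by omega)
    · intro h
      have := h2.mpr h
      exact ⟨h3 h, by omega⟩
  let f : Sym2 V → ℕ := Sym2.lift ⟨fun u v => (g u v).natAbs, fun u v => by
    simp only [h.antisymm u v, Int.natAbs_neg]⟩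
  have hf : ∀ u v, f s(u, v) = (g u v).natAbs := fun _ _ => rfl
  have hsum : ∀ v, D.orientedVertexSum f v = ∑ y, g v y := by
    intro v
    rw [Digraph.orientedVertexSum, Finset.sum_filter, Finset.sum_filter,
      ← Finset.sum_sub_distrib]
    refine Finset.sum_congr rfl fun y _ => ?_
    simp only [hD, hf]
    have := h.antisymm v y
    split_ifs <;> omega
  refine ⟨D, ⟨fun u v h1 h2 => ?_, hDG⟩, f, ⟨?_, ?_⟩, ?_⟩
  · have := h.antisymm u v
    rw [hD] at h1 h2
    omega
  · rw [Digraph.edgeSet, hDG]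
    rintro ⟨u, v⟩ h1 ⟨x, y⟩ h2 heq
    exact h.inj u v x y h1 h2 heq
  · rw [Digraph.edgeSet, hDG]
    rintro ⟨u, v⟩ h1
    exact h.mem u v h1
  · intro u v hu hv huv
    rw [hDG] at hu hv
    rw [hsum, hsum]
    exact hg u v hu hv huv

/-- Every graph on `n` vertices has an orientation and an injective labeling with labels at most
`|E(G)| + k` and distinct sums at the non-isolated vertices, for all `k ≥ n / 2 - 1`. -/
theorem exists_signedLabeling_sum_ne [Fintype V] (G : SimpleGraph V) {k : ℕ}
    (hk : Fintype.card V / 2 ≤ k + 1) :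
    ∃ g, IsSignedLabeling g G (Set.Icc 1 (G.edgeSet.ncard + k)) ∧
      ∀ u v, ¬ G.IsIsolated u → ¬ G.IsIsolated v → u ≠ v → ∑ y, g u y ≠ ∑ y, g v y := by
  classical
  obtain ⟨N, C, π, hNC, hcover, hN, hC⟩ :=
    G.exists_star_cover (Finset.univ.filter fun v => ¬ G.IsIsolated v) (by simp)
  have hdisj := Finset.disjoint_left.mp hNC
  -- `F` consists of the star edges, `H` of the edges that do not cross the boundary of `N`, and `X`
  -- of the remaining edges.
  let F : SimpleGraph V :=
    { Adj := fun u v => (u ∈ N ∧ π u = v) ∨ (v ∈ N ∧ π v = u)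
      symm := ⟨fun u v h => h.symm⟩
      loopless := ⟨fun u h => by
        have hu : u ∈ N ∧ π u = u := by tauto
        exact (hN u hu.1).2.ne hu.2.symm⟩ }
  let H : SimpleGraph V :=
    { Adj := fun u v => G.Adj u v ∧ (u ∈ N ↔ v ∈ N)
      symm := ⟨fun u v h => ⟨h.1.symm, h.2.symm⟩⟩
      loopless := ⟨fun u h => h.1.ne rfl⟩ }
  have hFadj : ∀ u v, F.Adj u v ↔ (u ∈ N ∧ π u = v) ∨ (v ∈ N ∧ π v = u) := fun _ _ => Iff.rfl
  have hHadj : ∀ u v, H.Adj u v ↔ G.Adj u v ∧ (u ∈ N ↔ v ∈ N) := fun _ _ => Iff.rfl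
  have hFG : F ≤ G := by
    rintro u v (⟨h1, rfl⟩ | ⟨h1, rfl⟩)
    · exact (hN u h1).2
    · exact (hN v h1).2.symm
  have hHF : H ≤ G \ F := by
    intro u v h
    rw [hHadj] at h
    refine ⟨h.1, ?_⟩
    rw [hFadj]
    have h1 := hN u
    have h2 := hN v
    grind
  set X : SimpleGraph V := (G \ F) \ H with hX
  have hXadj : ∀ u v, X.Adj u v → ¬ (u ∈ N ↔ v ∈ N) := fun u v h h' =>
    h.2 ⟨h.1.1, h'⟩
  -- Counting the edges of the three graphs.
  set M := X.edgeSet.ncard + H.edgeSet.ncard with hM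
  have hMcard : M = (G \ F).edgeSet.ncard := by
    rw [hM, hX, edgeSet_sdiff (G \ F) H]
    exact Set.ncard_sdiff_add_ncard_of_subset (edgeSet_mono hHF)
  have hNF : N.card ≤ F.edgeSet.ncard := by
    rw [← Set.ncard_coe_finset]
    refine Set.ncard_le_ncard_of_injOn (fun v => s(v, π v)) (fun v hv => Or.inl ⟨hv, rfl⟩) ?_
    intro u hu v hv huv
    have h1 := hN u hu
    have h2 := hN v hv
    have := hdisj hu
    rcases Sym2.eq_iff.mp huv with h | h
    · exact h.1
    · exact absurd (h.1 ▸ h2.1) this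
  have hcount : M + N.card ≤ G.edgeSet.ncard := by
    have := Set.ncard_sdiff_add_ncard_of_subset (edgeSet_mono hFG)
    rw [← edgeSet_sdiff, ← hMcard] at this
    omega
  -- Each star has a leaf, so there are at most `n / 2` centers.
  have hCN : C.card ≤ N.card := by
    refine (Finset.card_le_card fun c hc => ?_).trans (Finset.card_image_le (s := N) (f := π))
    obtain ⟨v, hv, rfl⟩ := hC c hc
    exact Finset.mem_image_of_mem π hv
  have hcardV : N.card + C.card ≤ Fintype.card V := by
    rw [← Finset.card_union_of_disjoint hNC]
    exact Finset.card_le_univ _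
  -- Reorient `X` towards `N`, and reverse `H` outside `N`.
  obtain ⟨gX₀, hgX₀, -⟩ := exists_signedLabeling X 0
  obtain ⟨gH₀, hgH₀, hsumH⟩ := exists_signedLabeling H X.edgeSet.ncard
  let gX : V → V → ℤ := fun u v => if u ∈ N then |gX₀ u v| else -|gX₀ u v|
  let gH : V → V → ℤ := fun u v => if u ∈ N then gH₀ u v else -gH₀ u v
  have hgX : IsSignedLabeling gX X (Set.Ioc 0 (0 + X.edgeSet.ncard)) := by
    refine hgX₀.reorient (fun u v => ?_) (fun u v => ?_)
    · have h1 := hgX₀.antisymm u v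
      by_cases huv : X.Adj u v
      · have := hXadj u v huv
        simp only [gX, h1, abs_neg]
        split_ifs <;> first | tauto | simp
      · simp [gX, h1, hgX₀.eq_zero huv]
    · simp only [gX]
      split_ifs <;> simp only [Int.natAbs_neg, Int.natAbs_abs]
  have hgH : IsSignedLabeling gH H (Set.Ioc X.edgeSet.ncard M) := by
    refine hgH₀.reorient (fun u v => ?_) (fun u v => ?_)
    · have h1 := hgH₀.antisymm u v
      by_cases huv : H.Adj u v
      · have := huv.2
        simp only [gH, h1]
        split_ifs <;> tauto
      · simp [gH, h1, hgH₀.eq_zero huv]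
    · simp only [gH]
      split_ifs <;> simp
  have hgK := hgX.add hgH (fun u v h => h.2) (by
    rw [Set.disjoint_left]; intro a h1 h2; simp only [Set.mem_Ioc] at h1 h2; omega)
  rw [sdiff_sup_cancel hHF] at hgK
  replace hgK := hgK.mono (A' := Set.Ioc 0 M) fun a ha => by
    simp only [Set.mem_union, Set.mem_Ioc] at ha ⊢
    omega
  -- The sums without the star edges.
  let w : V → ℤ := fun v => ∑ y, (gX + gH) v y
  have hwN : ∀ v ∈ N, -(M : ℤ) ≤ w v := by
    intro v hv
    have h1 : 0 ≤ ∑ y, gX v y := Finset.sum_nonneg fun y _ => by simp [gX, hv]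
    have h2 := hsumH v
    simp only [w, Pi.add_apply, Finset.sum_add_distrib]
    simp only [gH, hv, if_true]
    linarith
  have hwC : ∀ v ∈ C, w v ≤ (M : ℤ) := by
    intro v hv
    have hv : v ∉ N := fun h => hdisj h hv
    have h1 : ∑ y, gX v y ≤ 0 := Finset.sum_nonpos fun y _ => by simp [gX, hv]
    have h2 := hsumH v
    simp only [w, Pi.add_apply, Finset.sum_add_distrib]
    simp only [gH, hv, if_false, Finset.sum_neg_distrib]
    linarith
  -- The star edges get labels larger than `M`, and are oriented towards their leaves.
  obtain ⟨x, hxS, hx, hxN, hxC⟩ := exists_labels N C π (fun v hv => (hN v hv).1) hC w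
    (Finset.Ioc (M : ℤ) (G.edgeSet.ncard + k : ℕ)) (by
      rw [Int.card_Ioc]; omega)
  simp only [Finset.mem_Ioc] at hxS
  let gF : V → V → ℤ := fun u v =>
    if u ∈ N ∧ π u = v then x u else if v ∈ N ∧ π v = u then - x v else 0
  have hgF : IsSignedLabeling gF F
      (Set.Ioc M (G.edgeSet.ncard + k)) := by
    have h1 : ∀ u ∈ N, ∀ v ∈ N, π u ≠ v := fun u hu v hv h => hdisj hv (h ▸ (hN u hu).1)
    have hFN : ∀ u v, F.Adj u v →
        ∃ z ∈ N, s(u, v) = s(z, π z) ∧ (gF u v).natAbs = (x z).natAbs := by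
      rintro u v (⟨h, rfl⟩ | ⟨h, rfl⟩)
      · exact ⟨u, h, rfl, by simp [gF, h]⟩
      · refine ⟨v, h, Sym2.eq_swap, ?_⟩
        have : π v ∉ N := fun h' => h1 v h _ h' rfl
        simp [gF, h, this]
    refine ⟨fun u v => ?_, fun u v => ?_, fun u v y z huv hyz heq => ?_, fun u v huv => ?_⟩
    · simp only [gF]
      have := h1 u
      have := h1 v
      split_ifs <;> grind
    · rw [hFadj]
      have h2 := hxS u
      have h3 := hxS v
      simp only [gF]
      split_ifs <;> grind
    · obtain ⟨a, ha, h2, h3⟩ := hFN u v huv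
      obtain ⟨b, hb, h4, h5⟩ := hFN y z hyz
      have h6 := hxS a ha
      have h7 := hxS b hb
      rw [h2, h4, hx ha hb (by omega)]
    · obtain ⟨a, ha, h2, h3⟩ := hFN u v huv
      have h6 := hxS a ha
      rw [h3, Set.mem_Ioc]
      omega
  have hFsumN : ∀ v ∈ N, ∑ y, gF v y = x v := by
    intro v hv
    rw [Finset.sum_eq_single (π v)]
    · simp [gF, hv]
    · intro y _ hy
      have : ¬ (y ∈ N ∧ π y = v) := fun h => hdisj hv (h.2 ▸ (hN y h.1).1)
      simp [gF, hy.symm, this]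
    · simp
  have hFsumC : ∀ c ∈ C, ∑ y, gF c y = -∑ v ∈ N with π v = c, x v := by
    intro c hc
    have hcN : c ∉ N := fun h => hdisj h hc
    have : (N.filter fun v => π v = c) = Finset.univ.filter fun v => v ∈ N ∧ π v = c := by
      ext v; simp
    rw [← Finset.sum_neg_distrib, this, Finset.sum_filter]
    exact Finset.sum_congr rfl fun y _ => by simp [gF, hcN]
  have hg := hgK.add hgF (fun u v h => h.2) (by
    rw [Set.disjoint_left]
    intro a h1 h2
    simp only [Set.mem_Ioc] at h1 h2
    omega)
  rw [sdiff_sup_cancel hFG] at hg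
  have hsumN : ∀ v ∈ N, ∑ y, (gX + gH + gF) v y = x v + w v := by
    intro v hv
    have : ∑ y, (gX + gH + gF) v y = w v + ∑ y, gF v y := Finset.sum_add_distrib
    rw [this, hFsumN v hv, add_comm]
  have hsumC : ∀ c ∈ C, ∑ y, (gX + gH + gF) c y = w c - ∑ v ∈ N with π v = c, x v := by
    intro v hv
    have : ∑ y, (gX + gH + gF) v y = w v + ∑ y, gF v y := Finset.sum_add_distrib
    rw [this, hFsumC v hv, sub_eq_add_neg]
  have hpos : ∀ v ∈ N, 0 < ∑ y, (gX + gH + gF) v y := by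
    intro v hv
    rw [hsumN v hv]
    linarith [hwN v hv, (hxS v hv).1]
  have hneg : ∀ c ∈ C, ∑ y, (gX + gH + gF) c y < 0 := by
    intro c hc
    rw [hsumC c hc]
    obtain ⟨v, hv, hvc⟩ := hC c hc
    have : x v ≤ ∑ v ∈ N with π v = c, x v :=
      Finset.single_le_sum (f := x) (fun z hz => by
        linarith [(hxS z (Finset.mem_filter.mp hz).1).1, Int.natCast_nonneg M])
        (Finset.mem_filter.mpr ⟨hv, hvc⟩)
    linarith [hwC c hc, (hxS v hv).1]
  refine ⟨gX + gH + gF, hg.mono ?_, fun u v hu hv huv heq => huv ?_⟩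
  · intro a ha
    simp only [Set.mem_union, Set.mem_Ioc, Set.mem_Icc] at ha ⊢
    omega
  · have hu' := Finset.mem_union.mp (hcover (Finset.mem_filter.mpr ⟨Finset.mem_univ u, hu⟩))
    have hv' := Finset.mem_union.mp (hcover (Finset.mem_filter.mpr ⟨Finset.mem_univ v, hv⟩))
    rcases hu' with hu' | hu' <;> rcases hv' with hv' | hv'
    · rw [hsumN u hu', hsumN v hv'] at heq
      exact hxN hu' hv' heq
    · linarith [hpos u hu', hneg v hv']
    · linarith [hpos v hv', hneg u hu']
    · rw [hsumC u hu', hsumC v hv'] at heq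
      exact hxC hu' hv' heq

end SimpleGraph

theorem mainTheorem2 {V : Type*} [Fintype V] (G : SimpleGraph V) :
    (∃ D : Digraph V, D.IsOrientationOf G ∧
      D.IsQuasiOrientedAntimagic (2 * Fintype.card V / 3)) ∧
    ((∀ v : V, ¬ G.IsIsolated v) →
      ∃ D : Digraph V, D.IsOrientationOf G ∧
        D.IsOrientedAntimagic (2 * Fintype.card V / 3)) := by
  obtain ⟨g, hg, hsum⟩ := G.exists_signedLabeling_sum_ne (k := 2 * Fintype.card V / 3) (by omega)
  obtain ⟨D, hD, f, hf, hDf⟩ := hg.exists_digraph hsum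
  refine ⟨⟨D, hD, f, hf, hDf⟩, fun hG => ⟨D, hD, f, hf, fun u v => hDf u v ?_ ?_⟩⟩
  · rw [hD.2]; exact hG u
  · rw [hD.2]; exact hG v
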